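/- Proposition (faithfulness of the $\alpha$-logarithmic resourcefulness). Let $\mathcal H$ be a finite-dimensional complex Hilbert space, and let $\mathcal S_F$ (the free states of a resource theory) be a set of density operators on $\mathcal H$. Let $\mathcal P$ be a linear map on the operators of $\mathcal H$ that is Hermiticity-preserving and trace-preserving and satisfies $\mathcal P(\sigma)\in\mathcal S_F$ for all $\sigma\in\mathcal S_F$. For $\alpha\in[1,\infty]$, a Hermitian operator $X\neq 0$ and a positive semi-definite operator $\sigma\ne0$, put $$\mu_\alpha(X\Vert\sigma)=\left\Vert\sigma^{\frac{1-\alpha}{2\alpha}}X\sigma^{\frac{1-\alpha}{2\alpha}}\right\Vert_\alpha\ \text{ if } \operatorname{supp}(X)\subseteq\operatorname{supp}(\sigma),\qquad \mu_\alpha(X\Vert\sigma)=+\infty\ \text{ otherwise},$$ where $\Vert Y\Vert_\alpha=(\operatorname{Tr}[|Y|^\alpha])^{1/\alpha}$ with $|Y|=\sqrt{Y^\dagger Y}$, $\Vert\cdot\Vert_\infty$ is the operator norm, powers of $\sigma$ are taken on its support, and the exponent is $-\frac12$ for $\alpha=\infty$. Let $\nu_\alpha=\log_2\mu_\alpha$,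 and for a density operator $\rho$ define $$R_\alpha^{\mathcal P}(\rho)=\inf_{\sigma\in\mathcal S_F}\nu_\alpha(\mathcal P(\rho)\Vert\sigma)\in[-\infty,+\infty],$$ where the infimum over the empty set is $+\infty$. Fix $\alpha\in[1,\infty]$. Then $R_\alpha^{\mathcal P}(\rho)\ge 0$ for every density operator $\rho$, and $R_\alpha^{\mathcal P}(\rho)=0$ if $\rho\in\mathcal S_F$. If in addition $\mathcal S_F$ is closed, every density operator $\sigma$ with $\mathcal P(\sigma)\in\mathcal S_F$ lies in $\mathcal S_F$, and $\alpha>1$, then every density operator $\rho$ with $R_\alpha^{\mathcal P}(\rho)=0$ lies in $\mathcal S_F$. -/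

import Mathlib

open scoped ENNReal ComplexOrder

noncomputable section

namespace AlphaResource

variable {n : Type*} [Fintype n] [DecidableEq n]

/-- The quantum states (density operators) of a finite-dimensional system: positive semi-definite
matrices of unit trace. -/
def states (n : Type*) [Fintype n] : Set (Matrix n n ℂ) :=
  {ρ | ρ.PosSemidef ∧ ρ.trace = 1}

/-- The map sends Hermitian operators to Hermitian operators. -/
def HermiticityPreserving (P : Matrix n n ℂ →ₗ[ℂ] Matrix n n ℂ) : Prop :=
  ∀ X : Matrix n n ℂ, X.IsHermitian → (P X).IsHermitian

/-- The map preserves the trace. -/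
def TracePreserving (P : Matrix n n ℂ →ₗ[ℂ] Matrix n n ℂ) : Prop :=
  ∀ X : Matrix n n ℂ, (P X).trace = X.trace

/-- The support of a Hermitian operator: the orthogonal complement of its kernel, which for a
Hermitian operator is its range. -/
def supp (X : Matrix n n ℂ) : Submodule ℂ (n → ℂ) :=
  LinearMap.range X.mulVecLin

/-- The generalized power `σ ^ s` of a positive semi-definite operator, taken on its support: by
functional calculus, `x ↦ x ^ s` for the nonzero eigenvalues, and `0 ↦ 0` for every `s`. -/
def genPow (σ : Matrix n n ℂ) (s : ℝ) : Matrix n n ℂ :=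
  cfc (fun x : ℝ => if x = 0 then 0 else x ^ s) σ

/-- `|Y| = √(Y† Y)`. -/
def absOp (Y : Matrix n n ℂ) : Matrix n n ℂ :=
  cfc Real.sqrt (Y.conjTranspose * Y)

/-- The `α`-norm: `(Tr |Y| ^ α) ^ (1 / α)` for finite `α`, and the operator norm with respect to
the Euclidean norm for `α = ∞`. -/
def alphaNorm (α : ℝ≥0∞) (Y : Matrix n n ℂ) : ℝ :=
  if α = ⊤ then ‖Matrix.toEuclideanCLM (n := n) (𝕜 := ℂ) Y‖
  else ((cfc (fun x : ℝ => x ^ α.toReal) (absOp Y)).trace.re) ^ (1 / α.toReal)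

/-- The exponent `(1 - α) / (2 α)`, with its limit `- 1 / 2` for `α = ∞`. -/
def exponent (α : ℝ≥0∞) : ℝ :=
  if α = ⊤ then -1 / 2 else (1 - α.toReal) / (2 * α.toReal)

open scoped Classical in
/-- `μ_α(X ‖ σ) = ‖σ ^ ((1 - α) / (2 α)) X σ ^ ((1 - α) / (2 α))‖_α` if `supp X ⊆ supp σ`, and
`+∞` otherwise. -/
def mu (α : ℝ≥0∞) (X σ : Matrix n n ℂ) : ℝ≥0∞ :=
  if supp X ≤ supp σ then
    ENNReal.ofReal (alphaNorm α (genPow σ (exponent α) * X * genPow σ (exponent α)))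
  else ⊤

/-- `ν_α(X ‖ σ) = log₂ μ_α(X ‖ σ)`, an extended real number. -/
def nu (α : ℝ≥0∞) (X σ : Matrix n n ℂ) : EReal :=
  ENNReal.log (mu α X σ) / ((Real.log 2 : ℝ) : EReal)

/-- The `α`-logarithmic resourcefulness `R_α^P(ρ) = inf_{σ ∈ S_F} ν_α(P(ρ) ‖ σ)` for the set `SF`
of free states; the infimum is taken in the extended reals. -/
def resourcefulness (SF : Set (Matrix n n ℂ)) (P : Matrix n n ℂ →ₗ[ℂ] Matrix n n ℂ)
    (α : ℝ≥0∞) (ρ : Matrix n n ℂ) : EReal :=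
  ⨅ σ ∈ SF, nu α (P ρ) σ

end AlphaResource

end

/-! Write t = (α - 1)/(2α), σ = V diag(p) V† and σ^(-t) X σ^(-t) = W diag(x) W†, so that X = σ^t W
diag(x) W† σ^t when supp X ⊆ supp σ. With the doubly stochastic weights w i j = |(V†W) i j|², the
condition Tr X = 1 reads ∑ p_i^(2t) w_ij x_j = 1. For finite α, averaging the tangent inequality for
|x|^α at p_i^(1/α) gives ‖x‖_α ≥ 1; for α = ∞ a weighted mean of the x_j equals 1. If α > 1 and
equality holds, then x_j = p_i^(1/α) wherever p_i and w_ij are nonzero (1/α read as 0 at ∞), which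
forces X = σ (`one_le_norm_of_trace_eq_one`). Zero resourcefulness only gives near-minimizers.
Compactness is applied to the data (V, W, p, x) rather than to σ: for t > 0 the formula for X is
continuous even where eigenvalues of σ vanish, and the bound needs no relation of x to the limit of
σ beyond that formula (`mem_of_forall_exists_mu_lt`). -/

namespace AlphaResource

/-! ### Scalar Hölder inequality and its equality case -/

section Scalar

/-- The tangent line inequality for `|x| ^ a` at the point `p ^ (1 / a)`. -/
lemma tangent_le_abs_rpow {a p t : ℝ} (ha : 1 ≤ a) (ht : 2 * t = 1 - 1 / a) (hp : 0 < p) (x : ℝ) :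
    p + a * (p ^ t * p ^ t) * (x - p ^ (1 - 2 * t)) ≤ |x| ^ a ∧
    (1 < a → |x| ^ a = p + a * (p ^ t * p ^ t) * (x - p ^ (1 - 2 * t)) →
      x = p ^ (1 - 2 * t)) := by
  set b := p ^ (1 - 2 * t) with hb
  have hb0 : 0 < b := Real.rpow_pos_of_pos hp _
  have ha0 : 0 < a := by linarith
  have hc0 : 0 < p ^ t * p ^ t := by positivity
  have hcb : p ^ t * p ^ t * b = p := by
    rw [hb, ← Real.rpow_add hp, ← Real.rpow_add hp]
    ring_nf; simp
  have hba : b ^ a = p := by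
    rw [hb, ← Real.rpow_mul hp.le, ht, sub_sub_cancel, one_div, inv_mul_cancel₀ ha0.ne',
      Real.rpow_one]
  -- Since b ^ a = p, rescaling by b reduces the tangent inequality to Bernoulli's, which is strict
  -- off |x| = b when a > 1.
  have hx : |x| ^ a = p * (1 + (|x| / b - 1)) ^ a := by
    rw [add_sub_cancel, Real.div_rpow (abs_nonneg _) hb0.le, hba]
    field_simp
  have hs : -1 ≤ |x| / b - 1 := by
    have : 0 ≤ |x| / b := by positivity
    linarith
  have hlin : p * (1 + a * (|x| / b - 1)) = p + a * (p ^ t * p ^ t) * (|x| - b) := by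
    have : p * (1 + a * (|x| / b - 1)) =
        p ^ t * p ^ t * b * (1 + a * (|x| / b - 1)) := by rw [hcb]
    rw [this]
    conv_rhs => enter [1]; rw [← hcb]
    generalize p ^ t * p ^ t = c
    field_simp
  have hab : a * (p ^ t * p ^ t) * (x - b) ≤ a * (p ^ t * p ^ t) * (|x| - b) := by
    gcongr; exact le_abs_self x
  refine ⟨?_, fun h1 heq => ?_⟩
  · have := mul_le_mul_of_nonneg_left (one_add_mul_self_le_rpow_one_add hs ha) hp.le
    rw [← hx, hlin] at this
    linarith
  · have habs : |x| = b := by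
      by_contra hne
      have hs' : |x| / b - 1 ≠ 0 := by
        rw [sub_ne_zero, Ne, div_eq_one_iff_eq hb0.ne']; exact hne
      have := mul_lt_mul_of_pos_left (one_add_mul_self_lt_rpow_one_add hs hs' h1) hp
      rw [← hx, hlin] at this
      linarith
    rw [habs, hba, sub_eq_add_neg] at heq
    have : a * (p ^ t * p ^ t) * (x + -b) = 0 := by linarith
    rcases mul_eq_zero.1 this with h | h
    · exact absurd h (by positivity)
    · linarith

variable {n : Type*} [Fintype n]

/-- A doubly stochastic form of Hölder's inequality, with its case of equality. -/
lemma one_le_norm_of_doublyStochastic {α : ℝ≥0∞} [Fact (1 ≤ α)] {p c : n → ℝ}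
    {w : n → n → ℝ} (hw : ∀ i j, 0 ≤ w i j) (hwr : ∀ i, ∑ j, w i j = 1)
    (hwc : ∀ j, ∑ i, w i j = 1) (hp : ∀ i, 0 ≤ p i) (hp1 : ∑ i, p i = 1)
    (hc : ∀ i, c i = if p i = 0 then 0 else p i ^ (-exponent α)) (x : PiLp α fun _ : n => ℝ)
    (hx : ∑ i, c i * c i * ∑ j, w i j * x j = 1) :
    1 ≤ ‖x‖ ∧ (1 < α → ‖x‖ ≤ 1 → ∀ i j, w i j ≠ 0 →
      c i * x j = c i * p i ^ (1 - 2 * -exponent α)) := by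
  have hα : 1 ≤ α := Fact.out
  by_cases htop : α = ⊤
  · subst htop
    have he : -exponent ⊤ = 1 / 2 := by simp [exponent]; norm_num
    have hcc : ∀ i, c i * c i = p i := fun i => by
      rw [hc, he]
      split_ifs with h
      · simp [h]
      · rw [← Real.sqrt_eq_rpow, Real.mul_self_sqrt (hp i)]
    have hxn : ∀ j, x j ≤ ‖x‖ := fun j =>
      (le_abs_self _).trans (PiLp.norm_apply_le x j)
    -- The defect is a sum of nonnegative terms, so equality makes each of them vanish.
    have key : ∑ i, ∑ j, p i * w i j * (‖x‖ - x j) = ‖x‖ - 1 := by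
      have : ∀ i, ∑ j, p i * w i j * (‖x‖ - x j) = p i * ‖x‖ - p i * ∑ j, w i j * x j := by
        intro i
        rw [Finset.mul_sum, ← mul_one (p i * ‖x‖), ← hwr i, Finset.mul_sum,
          ← Finset.sum_sub_distrib]
        exact Finset.sum_congr rfl fun j _ => by ring
      simp_rw [hcc] at hx
      rw [Finset.sum_congr rfl fun i _ => this i, Finset.sum_sub_distrib, hx, ← Finset.sum_mul,
        hp1, one_mul]
    have hnn : ∀ i j, 0 ≤ p i * w i j * (‖x‖ - x j) := fun i j =>
      mul_nonneg (mul_nonneg (hp i) (hw i j)) (sub_nonneg.2 (hxn j))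
    have h1 : 1 ≤ ‖x‖ := by
      have := Finset.sum_nonneg fun i (_ : i ∈ Finset.univ) =>
        Finset.sum_nonneg fun j (_ : j ∈ Finset.univ) => hnn i j
      rw [key] at this; linarith
    refine ⟨h1, fun _ hle i j hij => ?_⟩
    have hn : ‖x‖ = 1 := le_antisymm hle h1
    rw [hn, sub_self] at key
    rw [hn] at hnn
    have h0 := (Finset.sum_eq_zero_iff_of_nonneg fun i _ =>
        Finset.sum_nonneg fun j _ => hnn i j).1 key i (Finset.mem_univ _)
    have h0 := (Finset.sum_eq_zero_iff_of_nonneg fun j _ => hnn i j).1 h0 j (Finset.mem_univ _)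
    by_cases hpi : p i = 0
    · simp [hc, hpi]
    · have : x j = 1 := by
        rcases mul_eq_zero.1 h0 with h | h
        · exact absurd h (mul_ne_zero hpi hij)
        · linarith
      rw [this, he]; norm_num
  · have ha1 : 1 ≤ α.toReal := by
      simpa using (ENNReal.toReal_le_toReal ENNReal.one_ne_top htop).2 hα
    set a := α.toReal with ha
    have ha0 : 0 < a := by linarith
    set t := -exponent α with ht'
    have ht : 2 * t = 1 - 1 / a := by
      simp only [ht', exponent, htop, if_false, ← ha]
      field_simp; ring
    have hterm : ∀ i j, 0 ≤ |x j| ^ a - (p i + a * (c i * c i) * (x j - p i ^ (1 - 2 * t))) ∧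
        (1 < a → |x j| ^ a - (p i + a * (c i * c i) * (x j - p i ^ (1 - 2 * t))) = 0 →
          c i * x j = c i * p i ^ (1 - 2 * t)) := by
      intro i j
      by_cases hpi : p i = 0
      · simp only [hc, hpi, if_true]
        simp; positivity
      · have h := tangent_le_abs_rpow ha1 ht ((hp i).lt_of_ne' hpi) (x j)
        simp only [hc, hpi, if_false]
        refine ⟨sub_nonneg.2 h.1, fun h1 h0 => ?_⟩
        rw [h.2 h1 (sub_eq_zero.1 h0)]
    have hcb : ∀ i, c i * c i * p i ^ (1 - 2 * t) = p i := by
      intro i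
      rw [hc]
      split_ifs with h
      · simp [h]
      · have := (hp i).lt_of_ne' h
        rw [← Real.rpow_add this, ← Real.rpow_add this]
        ring_nf; simp
    have hnorm : ‖x‖ = (∑ j, |x j| ^ a) ^ (1 / a) := by
      rw [PiLp.norm_eq_sum (ha ▸ ha0)]; rfl
    -- Column sums collapse the power terms; by `hx` and `hcb` the two linear contributions, -a and
    -- +a, cancel.
    have key : ∑ i, ∑ j, w i j *
        (|x j| ^ a - (p i + a * (c i * c i) * (x j - p i ^ (1 - 2 * t)))) =
        ∑ j, |x j| ^ a - 1 := by
      have e1 : ∑ i, ∑ j, w i j * |x j| ^ a = ∑ j, |x j| ^ a := by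
        rw [Finset.sum_comm]
        exact Finset.sum_congr rfl fun j _ => by rw [← Finset.sum_mul, hwc, one_mul]
      have e2 : ∀ i, ∑ j, w i j *
          (|x j| ^ a - (p i + a * (c i * c i) * (x j - p i ^ (1 - 2 * t)))) =
          ∑ j, w i j * |x j| ^ a - p i - a * (c i * c i * ∑ j, w i j * x j) + a * p i := by
        intro i
        have : ∑ j, w i j * (|x j| ^ a - (p i + a * (c i * c i) * (x j - p i ^ (1 - 2 * t)))) =
          ∑ j, w i j * |x j| ^ a - p i * ∑ j, w i j - a * (c i * c i * ∑ j, w i j * x j)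
            + a * (c i * c i * p i ^ (1 - 2 * t)) * ∑ j, w i j := by
          simp only [Finset.mul_sum, ← Finset.sum_sub_distrib, ← Finset.sum_add_distrib]
          exact Finset.sum_congr rfl fun j _ => by ring
        rw [this, hwr, hcb]; ring
      rw [Finset.sum_congr rfl fun i _ => e2 i, Finset.sum_add_distrib, Finset.sum_sub_distrib,
        Finset.sum_sub_distrib, e1, hp1, ← Finset.mul_sum, ← Finset.mul_sum, hx, hp1]
      ring
    have hnn : ∀ i j, 0 ≤ w i j *
        (|x j| ^ a - (p i + a * (c i * c i) * (x j - p i ^ (1 - 2 * t)))) := fun i j =>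
      mul_nonneg (hw i j) (hterm i j).1
    have h1 : 1 ≤ ∑ j, |x j| ^ a := by
      have := Finset.sum_nonneg fun i (_ : i ∈ Finset.univ) =>
        Finset.sum_nonneg fun j (_ : j ∈ Finset.univ) => hnn i j
      rw [key] at this; linarith
    refine ⟨hnorm ▸ Real.one_le_rpow h1 (by positivity), fun hα1 hle i j hij => ?_⟩
    have ha1' : 1 < a := by
      simpa using (ENNReal.toReal_lt_toReal ENNReal.one_ne_top htop).2 hα1
    have hs : ∑ j, |x j| ^ a = 1 := by
      refine le_antisymm ?_ h1
      by_contra! hlt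
      exact absurd (hnorm ▸ Real.one_lt_rpow hlt (by positivity)) hle.not_gt
    rw [hs, sub_self] at key
    have h0 := (Finset.sum_eq_zero_iff_of_nonneg fun i _ =>
        Finset.sum_nonneg fun j _ => hnn i j).1 key i (Finset.mem_univ _)
    have h0 := (Finset.sum_eq_zero_iff_of_nonneg fun j _ => hnn i j).1 h0 j (Finset.mem_univ _)
    exact (hterm i j).2 ha1' ((mul_eq_zero.1 h0).resolve_left hij)

end Scalar

/-! ### Functional calculus, supports and compactness of the unitary group -/

section ConjDiag

variable {n : Type*} [Fintype n] [DecidableEq n]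

/-- The matrix `V diag(d) V†`. -/
def conjDiag (V : Matrix n n ℂ) (d : n → ℝ) : Matrix n n ℂ :=
  V * Matrix.diagonal (fun i => (d i : ℂ)) * star V

lemma cfc_eq_conjDiag {A : Matrix n n ℂ} (hA : A.IsHermitian) (f : ℝ → ℝ) :
    cfc f A = conjDiag hA.eigenvectorUnitary (fun i => f (hA.eigenvalues i)) := by
  rw [hA.cfc_eq]; rfl

lemma eq_conjDiag {A : Matrix n n ℂ} (hA : A.IsHermitian) :
    A = conjDiag hA.eigenvectorUnitary hA.eigenvalues :=
  hA.spectral_theorem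

lemma trace_conjDiag {V : Matrix n n ℂ} (hV : V ∈ unitary (Matrix n n ℂ)) (d : n → ℝ) :
    (conjDiag V d).trace = ∑ i, (d i : ℂ) := by
  rw [conjDiag, Matrix.trace_mul_comm, ← mul_assoc, Unitary.star_mul_self_of_mem hV, one_mul,
    Matrix.trace_diagonal]

lemma continuousOn_spectrum {A : Matrix n n ℂ} (f : ℝ → ℝ) : ContinuousOn f (spectrum ℝ A) :=
  Matrix.finite_real_spectrum.continuousOn f

lemma cfc_comp_matrix {A : Matrix n n ℂ} (hA : A.IsHermitian) (g f : ℝ → ℝ) :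
    cfc g (cfc f A) = cfc (fun x => g (f x)) A :=
  (cfc_comp' g f A (Matrix.finite_real_spectrum.image f |>.continuousOn g)
    (continuousOn_spectrum f) hA).symm

lemma cfc_mul_matrix {A : Matrix n n ℂ} (f g : ℝ → ℝ) :
    cfc f A * cfc g A = cfc (fun x => f x * g x) A :=
  (cfc_mul f g A (continuousOn_spectrum f) (continuousOn_spectrum g)).symm

lemma isHermitian_cfc (f : ℝ → ℝ) (A : Matrix n n ℂ) : (cfc f A).IsHermitian :=
  cfc_predicate f A

lemma cfc_id_matrix {A : Matrix n n ℂ} (hA : A.IsHermitian) : cfc (fun x : ℝ => x) A = A :=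
  cfc_id' ℝ A hA.isSelfAdjoint

lemma absOp_eq_cfc_abs {A : Matrix n n ℂ} (hA : A.IsHermitian) : 
    absOp A = cfc (fun x : ℝ => |x|) A := by
  have h : A.conjTranspose * A = cfc (fun x : ℝ => x * x) A := by
    rw [← cfc_mul_matrix, cfc_id_matrix hA, hA.eq]
  rw [absOp, h, cfc_comp_matrix hA]
  simp [Real.sqrt_mul_self_eq_abs]

open scoped Matrix.Norms.L2Operator in
lemma norm_toEuclideanCLM_conjDiag {V : Matrix n n ℂ} (hV : V ∈ unitary (Matrix n n ℂ))
    (d : n → ℝ) : ‖Matrix.toEuclideanCLM (n := n) (𝕜 := ℂ) (conjDiag V d)‖ = ‖d‖ := by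
  rw [← Matrix.cstar_norm_def, conjDiag, CStarRing.norm_mul_mem_unitary _ (Unitary.star_mem hV),
    CStarRing.norm_mem_unitary_mul _ hV, Matrix.l2_opNorm_diagonal]
  simp [Pi.norm_def]

/-- The `α`-norm of a Hermitian matrix is the `ℓ^α`-norm of its spectrum. -/
lemma alphaNorm_cfc {α : ℝ≥0∞} [Fact (1 ≤ α)] {A : Matrix n n ℂ} (hA : A.IsHermitian)
    (f : ℝ → ℝ) :
    alphaNorm α (cfc f A) = ‖WithLp.toLp α (fun i => f (hA.eigenvalues i))‖ := by
  by_cases h : α = ⊤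
  · subst h
    rw [alphaNorm, if_pos rfl, cfc_eq_conjDiag hA,
      norm_toEuclideanCLM_conjDiag hA.eigenvectorUnitary.2, PiLp.norm_toLp]
  · have h1 : 1 ≤ α := Fact.out
    have h0 : 0 < α.toReal := ENNReal.toReal_pos (by rintro rfl; simp at h1) h
    rw [alphaNorm, if_neg h, PiLp.norm_eq_sum h0, absOp_eq_cfc_abs (isHermitian_cfc f A),
      cfc_comp_matrix hA, cfc_comp_matrix hA, cfc_eq_conjDiag hA,
      trace_conjDiag hA.eigenvectorUnitary.2, ← Complex.ofReal_sum, Complex.ofReal_re]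
    rfl

lemma alphaNorm_eq_norm_eigenvalues {α : ℝ≥0∞} [Fact (1 ≤ α)] {A : Matrix n n ℂ}
    (hA : A.IsHermitian) : alphaNorm α A = ‖WithLp.toLp α hA.eigenvalues‖ := by
  conv_lhs => rw [← cfc_id_matrix hA]
  exact alphaNorm_cfc hA fun x => x

/-- A matrix whose range lies in that of a Hermitian matrix is fixed by the support projection. -/
lemma cfc_mul_of_supp_le {X A : Matrix n n ℂ} (hA : A.IsHermitian) (h : supp X ≤ supp A) :
    cfc (fun x : ℝ => if x = 0 then 0 else 1) A * X = X := by
  have hZ : ∀ j, ∃ z : n → ℂ, A.mulVec z = X.col j := fun j => by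
    have : X.mulVecLin (Pi.single j 1) ∈ supp A := h ⟨_, rfl⟩
    obtain ⟨z, hz⟩ := this
    exact ⟨z, by simpa using hz⟩
  choose z hz using hZ
  have hX : X = A * Matrix.of fun i j => z j i := by
    ext i j
    have := congrFun (hz j) i
    simpa [Matrix.mul_apply, Matrix.mulVec, dotProduct] using this.symm
  have hPA : cfc (fun x : ℝ => if x = 0 then 0 else 1) A * A = A := by
    have : cfc (fun x : ℝ => if x = 0 then 0 else 1) A * cfc (fun x : ℝ => x) A =
        cfc (fun x : ℝ => x) A := by
      rw [cfc_mul_matrix]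
      refine cfc_congr fun x _ => ?_
      by_cases hx : x = 0 <;> simp [hx]
    rwa [cfc_id_matrix hA] at this
  rw [hX, ← mul_assoc, hPA]

lemma genPow_mul_genPow {A : Matrix n n ℂ} (hA : A.PosSemidef) (s t : ℝ) :
    genPow A s * genPow A t = genPow A (s + t) := by
  rw [genPow, genPow, cfc_mul_matrix]
  refine cfc_congr fun x hx => ?_
  rw [hA.1.spectrum_real_eq_range_eigenvalues] at hx
  obtain ⟨i, rfl⟩ := hx
  by_cases h : hA.1.eigenvalues i = 0
  · simp [h]
  · simp only [h, if_false]
    rw [Real.rpow_add ((hA.eigenvalues_nonneg i).lt_of_ne' h)]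

lemma genPow_one {A : Matrix n n ℂ} (hA : A.IsHermitian) : genPow A 1 = A := by
  conv_rhs => rw [← cfc_id_matrix hA]
  refine cfc_congr fun x _ => ?_
  by_cases hx : x = 0 <;> simp [hx]

lemma isHermitian_genPow_conj {X : Matrix n n ℂ} (hX : X.IsHermitian) (A : Matrix n n ℂ) (s : ℝ) :
    (genPow A s * X * genPow A s).IsHermitian := by
  have h : (genPow A s).IsHermitian := isHermitian_cfc _ _
  have := Matrix.isHermitian_conjTranspose_mul_mul (genPow A s) hX
  rwa [h.eq] at this

lemma genPow_neg_conj {X A : Matrix n n ℂ} (hA : A.PosSemidef) (hX : X.IsHermitian)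
    (h : supp X ≤ supp A) (s : ℝ) :
    genPow A (-s) * (genPow A s * X * genPow A s) * genPow A (-s) = X := by
  -- The zeroth power sends 0 to 0, so it is the support projection and not the identity.
  have h0 : genPow A 0 * X = X := by
    have := cfc_mul_of_supp_le hA.1 h
    simpa [genPow] using this
  have h0' : X * genPow A 0 = X := by
    have := congrArg Matrix.conjTranspose h0
    have hG : (genPow A 0).IsHermitian := isHermitian_cfc _ A
    rwa [Matrix.conjTranspose_mul, hX.eq, hG.eq] at this
  calc _ = (genPow A (-s) * genPow A s) * X * (genPow A s * genPow A (-s)) := by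
        simp only [mul_assoc]
    _ = X := by
        rw [genPow_mul_genPow hA, genPow_mul_genPow hA, neg_add_cancel, add_neg_cancel, h0, h0']

lemma isCompact_unitary : IsCompact (unitary (Matrix n n ℂ) : Set (Matrix n n ℂ)) := by
  refine IsCompact.of_isClosed_subset (s := Set.univ.pi fun _ => Set.univ.pi fun _ =>
    Metric.closedBall (0 : ℂ) 1) (isCompact_univ_pi fun _ => isCompact_univ_pi fun _ =>
    isCompact_closedBall _ _) ?_ fun U hU i _ j _ => ?_
  · have : (unitary (Matrix n n ℂ) : Set (Matrix n n ℂ)) =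
        {U | star U * U = 1} ∩ {U | U * star U = 1} := by
      ext U; exact Unitary.mem_iff
    rw [this]
    exact (isClosed_eq (by fun_prop) continuous_const).inter
      (isClosed_eq (by fun_prop) continuous_const)
  · simpa using entry_norm_bound_of_unitary hU i j

end ConjDiag

/-! ### Rigidity of the lower bound -/

section Faithful

variable {n : Type*} [Fintype n] [DecidableEq n]

/-- Entrywise, `hb` says C (V†W) X = C B (V†W) for the diagonal matrices C, X, B; moving X across as
B lets W cancel against its adjoint. -/
lemma conjDiag_mul_mul_conjDiag {V W : Matrix n n ℂ} (hV : V ∈ unitary (Matrix n n ℂ))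
    (hW : W ∈ unitary (Matrix n n ℂ)) {c b p x : n → ℝ}
    (hb : ∀ i j, (star V * W) i j ≠ 0 → c i * x j = c i * b i)
    (hcb : ∀ i, c i * b i * c i = p i) :
    conjDiag V c * conjDiag W x * conjDiag V c = conjDiag V p := by
  have hVV := Unitary.star_mul_self_of_mem hV
  have hWW := Unitary.mul_star_self_of_mem hW
  have h1 : Matrix.diagonal (fun i => (c i : ℂ)) * (star V * W) *
      Matrix.diagonal (fun i => (x i : ℂ)) =
      Matrix.diagonal (fun i => (c i : ℂ)) * Matrix.diagonal (fun i => (b i : ℂ)) *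
        (star V * W) := by
    ext i j
    rw [Matrix.mul_diagonal, Matrix.diagonal_mul, Matrix.diagonal_mul_diagonal,
      Matrix.diagonal_mul]
    by_cases h : (star V * W) i j = 0
    · simp [h]
    · have := congrArg (Complex.ofReal) (hb i j h)
      push_cast at this
      rw [mul_right_comm, this]
  have h2 : Matrix.diagonal (fun i => (c i : ℂ)) * Matrix.diagonal (fun i => (b i : ℂ)) *
      Matrix.diagonal (fun i => (c i : ℂ)) = Matrix.diagonal (fun i => (p i : ℂ)) := by
    rw [Matrix.diagonal_mul_diagonal, Matrix.diagonal_mul_diagonal]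
    congr 1; ext i; rw [← hcb i]; push_cast; rfl
  simp only [conjDiag]
  generalize Matrix.diagonal (fun i => (c i : ℂ)) = C at *
  generalize Matrix.diagonal (fun i => (x i : ℂ)) = X at *
  generalize Matrix.diagonal (fun i => (b i : ℂ)) = B at *
  calc _ = V * (C * (star V * W) * X) * (star W * V * C * star V) := by simp only [mul_assoc]
    _ = V * (C * B) * (star V * (W * star W) * V) * C * star V := by
        rw [h1]; simp only [mul_assoc]
    _ = V * (C * B * C) * star V := by
        rw [hWW, mul_one, hVV, mul_one]; simp only [mul_assoc]
    _ = _ := by rw [h2]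

lemma sum_normSq_row {U : Matrix n n ℂ} (hU : U ∈ unitary (Matrix n n ℂ)) (i : n) :
    ∑ j, Complex.normSq (U i j) = 1 := by
  have : (U * star U) i i = (1 : Matrix n n ℂ) i i := by
    rw [Unitary.mul_star_self_of_mem hU]
  rw [Matrix.mul_apply, Matrix.one_apply_eq] at this
  have h : ((∑ j, Complex.normSq (U i j) : ℝ) : ℂ) = 1 := by
    rw [← this]; push_cast
    exact Finset.sum_congr rfl fun j _ => by
      rw [Matrix.star_apply, Complex.normSq_eq_conj_mul_self, mul_comm]; rfl
  exact_mod_cast h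

lemma trace_conjDiag_mul_mul {V W : Matrix n n ℂ} (hV : V ∈ unitary (Matrix n n ℂ))
    (c x : n → ℝ) :
    (conjDiag V c * conjDiag W x * conjDiag V c).trace =
      ((∑ i, c i * c i * ∑ j, Complex.normSq ((star V * W) i j) * x j : ℝ) : ℂ) := by
  have hVV := Unitary.star_mul_self_of_mem hV
  have h : (conjDiag V c * conjDiag W x * conjDiag V c).trace =
      (Matrix.diagonal (fun i => (c i : ℂ)) * Matrix.diagonal (fun i => (c i : ℂ)) *
        ((star V * W) * Matrix.diagonal (fun i => (x i : ℂ)) * star (star V * W))).trace := by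
    simp only [conjDiag]
    generalize Matrix.diagonal (fun i => (c i : ℂ)) = C
    generalize Matrix.diagonal (fun i => (x i : ℂ)) = X
    rw [Matrix.trace_mul_comm]
    calc _ = ((V * C) * ((star V * V) * C * star V * W * X * star W)).trace := by
          simp only [mul_assoc]
      _ = _ := by
          rw [hVV, one_mul, mul_assoc V, Matrix.trace_mul_comm, star_mul, star_star]
          simp only [mul_assoc]
  rw [h, Matrix.diagonal_mul_diagonal, Matrix.trace]
  push_cast
  refine Finset.sum_congr rfl fun i _ => ?_
  rw [Matrix.diag_apply, Matrix.diagonal_mul, Matrix.mul_apply]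
  congr 1
  refine Finset.sum_congr rfl fun j _ => ?_
  rw [Matrix.mul_diagonal, Matrix.star_apply, Complex.normSq_eq_conj_mul_self, mul_right_comm]
  exact congrArg (· * (x j : ℂ)) (mul_comm _ _)

lemma neg_exponent_pos {α : ℝ≥0∞} (hα : 1 < α) : 0 < -exponent α := by
  by_cases htop : α = ⊤
  · simp [exponent, htop]; norm_num
  · have ha1 : 1 < α.toReal := by
      simpa using (ENNReal.toReal_lt_toReal ENNReal.one_ne_top htop).2 hα
    rw [exponent, if_neg htop, ← neg_div]
    exact div_pos (by linarith) (by linarith)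

/-- The lower bound on the `ℓ^α`-norm of the spectrum of the sandwiched operator, and its case of
equality, in terms of spectral data. -/
lemma one_le_norm_of_trace_eq_one {α : ℝ≥0∞} [Fact (1 ≤ α)] {V W : Matrix n n ℂ}
    (hV : V ∈ unitary (Matrix n n ℂ)) (hW : W ∈ unitary (Matrix n n ℂ)) {p c : n → ℝ}
    (hp : ∀ i, 0 ≤ p i) (hp1 : ∑ i, p i = 1)
    (hc : ∀ i, c i = if p i = 0 then 0 else p i ^ (-exponent α)) (x : PiLp α fun _ : n => ℝ)
    (hx : (conjDiag V c * conjDiag W x * conjDiag V c).trace = 1) :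
    1 ≤ ‖x‖ ∧ (1 < α → ‖x‖ ≤ 1 →
      conjDiag V c * conjDiag W x * conjDiag V c = conjDiag V p) := by
  have hU : star V * W ∈ unitary (Matrix n n ℂ) := mul_mem (Unitary.star_mem hV) hW
  rw [trace_conjDiag_mul_mul hV] at hx
  have h := one_le_norm_of_doublyStochastic (w := fun i j => Complex.normSq ((star V * W) i j))
    (fun i j => Complex.normSq_nonneg _) (fun i => sum_normSq_row hU i)
    (fun j => by simpa [-star_mul] using sum_normSq_row (Unitary.star_mem hU) j) hp hp1 hc x
    (by exact_mod_cast hx)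
  refine ⟨h.1, fun hα hle => conjDiag_mul_mul_conjDiag hV hW
    (b := fun i => p i ^ (1 - 2 * -exponent α)) (fun i j hij => ?_) fun i => ?_⟩
  · exact h.2 hα hle i j (by simpa using hij)
  · rw [hc]
    split_ifs with h
    · simp [h]
    · have := (hp i).lt_of_ne' h
      rw [← Real.rpow_add this, ← Real.rpow_add this]
      ring_nf; simp

lemma sum_eigenvalues_of_mem_states {σ : Matrix n n ℂ} (hσ : σ ∈ states n) :
    ∑ i, hσ.1.1.eigenvalues i = 1 := by
  have : ((∑ i, hσ.1.1.eigenvalues i : ℝ) : ℂ) = 1 := by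
    refine Eq.trans ?_ (hσ.1.1.trace_eq_sum_eigenvalues.symm.trans hσ.2)
    push_cast; rfl
  exact_mod_cast this

/-- Spectral data for a state `σ` and a Hermitian operator supported in it. -/
lemma exists_spectral_data {α : ℝ≥0∞} [Fact (1 ≤ α)] {X σ : Matrix n n ℂ} (hX : X.IsHermitian)
    (hσ : σ ∈ states n) (h : supp X ≤ supp σ) :
    ∃ V ∈ unitary (Matrix n n ℂ), ∃ W ∈ unitary (Matrix n n ℂ), ∃ p ∈ stdSimplex ℝ n,
      ∃ x : PiLp α fun _ : n => ℝ, σ = conjDiag V p ∧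
        X = conjDiag V (fun i => if p i = 0 then 0 else p i ^ (-exponent α)) * conjDiag W x *
          conjDiag V (fun i => if p i = 0 then 0 else p i ^ (-exponent α)) ∧
        mu α X σ = ENNReal.ofReal ‖x‖ := by
  have hY := isHermitian_genPow_conj hX σ (exponent α)
  refine ⟨hσ.1.1.eigenvectorUnitary, hσ.1.1.eigenvectorUnitary.2, hY.eigenvectorUnitary,
    hY.eigenvectorUnitary.2, hσ.1.1.eigenvalues, ⟨hσ.1.eigenvalues_nonneg, ?_⟩,
    WithLp.toLp α hY.eigenvalues, eq_conjDiag _, ?_, ?_⟩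
  · exact sum_eigenvalues_of_mem_states hσ
  · have := genPow_neg_conj hσ.1 hX h (exponent α)
    rw [eq_conjDiag hY, genPow, cfc_eq_conjDiag hσ.1.1] at this
    exact this.symm
  · rw [mu, if_pos h, alphaNorm_eq_norm_eigenvalues hY]

lemma one_le_mu {α : ℝ≥0∞} (hα : 1 ≤ α) {X σ : Matrix n n ℂ} (hX : X.IsHermitian)
    (hX1 : X.trace = 1) (hσ : σ ∈ states n) : 1 ≤ mu α X σ := by
  have : Fact (1 ≤ α) := ⟨hα⟩
  by_cases h : supp X ≤ supp σ
  · obtain ⟨V, hV, W, hW, p, hp, x, -, rfl, hmu⟩ := exists_spectral_data (α := α) hX hσ h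
    rw [hmu, ENNReal.one_le_ofReal]
    exact (one_le_norm_of_trace_eq_one hV hW hp.1 hp.2 (fun _ => rfl) x hX1).1
  · rw [mu, if_neg h]; exact le_top

lemma mu_self_le_one {α : ℝ≥0∞} (hα : 1 ≤ α) {σ : Matrix n n ℂ} (hσ : σ ∈ states n) :
    mu α σ σ ≤ 1 := by
  have : Fact (1 ≤ α) := ⟨hα⟩
  -- The total exponent is 1/α, so for finite α the α-norm reduces to Tr σ = 1; for α = ∞ a support
  -- projection remains.
  have hG : genPow σ (exponent α) * σ * genPow σ (exponent α) =
      genPow σ (exponent α + 1 + exponent α) := by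
    conv_lhs => enter [1, 2]; rw [← genPow_one hσ.1.1]
    rw [genPow_mul_genPow hσ.1, genPow_mul_genPow hσ.1]
  rw [mu, if_pos le_rfl, hG, genPow, alphaNorm_cfc hσ.1.1, ENNReal.ofReal_le_one]
  by_cases h : α = ⊤
  · subst h
    rw [PiLp.norm_toLp, pi_norm_le_iff_of_nonneg zero_le_one]
    intro i
    have : exponent ⊤ + 1 + exponent ⊤ = 0 := by simp [exponent]; norm_num
    rw [this]
    split_ifs <;> simp
  · have h0 : 0 < α.toReal := ENNReal.toReal_pos (by rintro rfl; simp at hα) h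
    have he : (exponent α + 1 + exponent α) * α.toReal = 1 := by
      simp only [exponent, h, if_false]; field_simp; ring
    rw [PiLp.norm_eq_sum h0]
    refine (Real.rpow_le_rpow (Finset.sum_nonneg fun i _ => by positivity) (le_of_eq ?_)
      (by positivity)).trans (Real.one_rpow _).le
    refine (Finset.sum_congr rfl fun i _ => ?_).trans (sum_eigenvalues_of_mem_states hσ)
    have hi := hσ.1.eigenvalues_nonneg i
    simp only [Real.norm_eq_abs]
    split_ifs with hz
    · simp [hz, h0.ne']
    · rw [abs_of_nonneg (by positivity), ← Real.rpow_mul hi, he, Real.rpow_one]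

/-! ### Attainment of the infimum by compactness -/

lemma continuous_conjDiag {Z : Type*} [TopologicalSpace Z] {V : Z → Matrix n n ℂ} {d : Z → n → ℝ}
    (hV : Continuous V) (hd : Continuous d) : Continuous fun z => conjDiag (V z) (d z) := by
  unfold conjDiag
  exact (hV.mul (Continuous.matrix_diagonal (by fun_prop))).mul hV.star

/-- A Hermitian unit-trace operator whose divergences from a closed set of states come arbitrarily
close to their minimal value belongs to that set. -/
lemma mem_of_forall_exists_mu_lt {α : ℝ≥0∞} (hα : 1 < α) {SF : Set (Matrix n n ℂ)}
    (hSF : SF ⊆ states n) (hcl : IsClosed SF) {X : Matrix n n ℂ} (hX : X.IsHermitian)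
    (hX1 : X.trace = 1) (h : ∀ r : ℝ, 1 < r → ∃ σ ∈ SF, mu α X σ < ENNReal.ofReal r) :
    X ∈ SF := by
  have : Fact (1 ≤ α) := ⟨hα.le⟩
  have ht := neg_exponent_pos hα
  -- Here α > 1 matters: a positive exponent makes the case split redundant and the power continuous
  -- at 0.
  have hpow : ∀ y : ℝ, (if y = 0 then 0 else y ^ (-exponent α)) = y ^ (-exponent α) := fun y => by
    split_ifs with hy
    · rw [hy, Real.zero_rpow ht.ne']
    · rfl
  let c : (n → ℝ) → n → ℝ := fun p i => p i ^ (-exponent α)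
  have hccont : Continuous c :=
    continuous_pi fun i => (Real.continuous_rpow_const ht.le).comp (continuous_apply i)
  -- Any radius above 1 would do in place of 2.
  let K₀ : Set ((Matrix n n ℂ × Matrix n n ℂ) × (n → ℝ) × PiLp α fun _ : n => ℝ) :=
    ((unitary (Matrix n n ℂ) : Set _) ×ˢ (unitary (Matrix n n ℂ) : Set _)) ×ˢ
      (stdSimplex ℝ n ×ˢ Metric.closedBall 0 2)
  have hK₀ : IsCompact K₀ :=
    (isCompact_unitary.prod isCompact_unitary).prod
      ((isCompact_stdSimplex ℝ n).prod (isCompact_closedBall _ _))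
  let F : (Matrix n n ℂ × Matrix n n ℂ) × (n → ℝ) × (PiLp α fun _ : n => ℝ) → Matrix n n ℂ :=
    fun z => conjDiag z.1.1 (c z.2.1) * conjDiag z.1.2 z.2.2 * conjDiag z.1.1 (c z.2.1)
  have hF : Continuous F :=
    ((continuous_conjDiag (by fun_prop) (hccont.comp (by fun_prop))).mul
      (continuous_conjDiag (by fun_prop) (by fun_prop))).mul
      (continuous_conjDiag (by fun_prop) (hccont.comp (by fun_prop)))
  let K := K₀ ∩ ({z | conjDiag z.1.1 z.2.1 ∈ SF} ∩ {z | F z = X})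
  have hK : IsCompact K := hK₀.inter_right
    ((hcl.preimage (continuous_conjDiag (by fun_prop) (by fun_prop))).inter
      (isClosed_eq hF continuous_const))
  have hex : ∀ r : ℝ, 1 < r → r ≤ 2 → ∃ z ∈ K, ‖z.2.2‖ < r := by
    intro r hr hr2
    obtain ⟨σ, hσ, hlt⟩ := h r hr
    have hsupp : supp X ≤ supp σ := by
      by_contra hn
      rw [mu, if_neg hn] at hlt
      exact not_top_lt hlt
    obtain ⟨V, hV, W, hW, p, hp, x, hσV, hXV, hmu⟩ :=
      exists_spectral_data (α := α) hX (hSF hσ) hsupp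
    rw [hmu, ENNReal.ofReal_lt_ofReal_iff (by linarith)] at hlt
    simp only [hpow] at hXV
    refine ⟨((V, W), (p, x)), ⟨⟨⟨hV, hW⟩, hp, ?_⟩, ?_, hXV.symm⟩, hlt⟩
    · rw [mem_closedBall_zero_iff]; linarith
    · show conjDiag V p ∈ SF
      rw [← hσV]; exact hσ
  obtain ⟨z₂, hz₂, -⟩ := hex 2 one_lt_two le_rfl
  obtain ⟨z, hz, hmin⟩ := hK.exists_isMinOn ⟨z₂, hz₂⟩
    (f := fun z => ‖z.2.2‖) (Continuous.continuousOn (by fun_prop))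
  have hle : ‖z.2.2‖ ≤ 1 := by
    by_contra! hgt
    obtain ⟨y, hy, hlt⟩ := hex (min ‖z.2.2‖ 2) (lt_min hgt one_lt_two) (min_le_right _ _)
    exact absurd (hmin hy) (not_le.2 (hlt.trans_le (min_le_left _ _)))
  obtain ⟨⟨⟨hV, hW⟩, hp, -⟩, hzSF, hzX⟩ := hz
  have := (one_le_norm_of_trace_eq_one hV hW hp.1 hp.2 (fun i => (hpow _).symm) z.2.2
    ((congrArg Matrix.trace hzX).trans hX1)).2 hα hle
  rw [← show F z = X from hzX, show F z = _ from this]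
  exact hzSF

lemma log_two_pos_ereal : (0 : EReal) < ((Real.log 2 : ℝ) : EReal) := by
  exact_mod_cast Real.log_pos one_lt_two

lemma nu_nonneg {α : ℝ≥0∞} {X σ : Matrix n n ℂ} (h : 1 ≤ mu α X σ) : 0 ≤ nu α X σ :=
  EReal.div_nonneg (ENNReal.zero_le_log_iff.2 h) log_two_pos_ereal.le

lemma nu_nonpos {α : ℝ≥0∞} {X σ : Matrix n n ℂ} (h : mu α X σ ≤ 1) : nu α X σ ≤ 0 :=
  EReal.div_nonpos_of_nonpos_of_nonneg (ENNReal.log_le_zero_iff.2 h) log_two_pos_ereal.le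

end Faithful

end AlphaResource

open AlphaResource in
theorem mainTheorem12 {n : Type*} [Fintype n] [DecidableEq n]
    (SF : Set (Matrix n n ℂ)) (hSF : SF ⊆ AlphaResource.states n)
    (P : Matrix n n ℂ →ₗ[ℂ] Matrix n n ℂ)
    (hHerm : AlphaResource.HermiticityPreserving P)
    (hTrace : AlphaResource.TracePreserving P)
    (hFree : ∀ σ ∈ SF, P σ ∈ SF)
    (α : ℝ≥0∞) (hα : 1 ≤ α) :
    (∀ ρ ∈ AlphaResource.states n, 0 ≤ AlphaResource.resourcefulness SF P α ρ) ∧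
    (∀ ρ ∈ SF, AlphaResource.resourcefulness SF P α ρ = 0) ∧
    (IsClosed SF → (∀ σ ∈ AlphaResource.states n, P σ ∈ SF → σ ∈ SF) → 1 < α →
      ∀ ρ ∈ AlphaResource.states n,
        AlphaResource.resourcefulness SF P α ρ = 0 → ρ ∈ SF) := by
  have hnonneg : ∀ ρ ∈ states n, 0 ≤ resourcefulness SF P α ρ := fun ρ hρ =>
    le_iInf₂ fun σ hσ => nu_nonneg
      (one_le_mu hα (hHerm ρ hρ.1.1) ((hTrace ρ).trans hρ.2) (hSF hσ))
  refine ⟨hnonneg, fun ρ hρ => le_antisymm ?_ (hnonneg ρ (hSF hρ)), ?_⟩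
  · exact (iInf₂_le (P ρ) (hFree ρ hρ)).trans
      (nu_nonpos (mu_self_le_one hα (hSF (hFree ρ hρ))))
  · intro hcl hrefl hα1 ρ hρ h0
    refine hrefl ρ hρ (mem_of_forall_exists_mu_lt hα1 hSF hcl (hHerm ρ hρ.1.1)
      ((hTrace ρ).trans hρ.2) fun r hr => ?_)
    -- An infimum 0 lies below log₂ r, so some free σ does too.
    have hpos : 0 < ENNReal.log (ENNReal.ofReal r) / ((Real.log 2 : ℝ) : EReal) :=
      EReal.div_pos (ENNReal.zero_lt_log_iff.2 (ENNReal.one_lt_ofReal.2 hr))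
        log_two_pos_ereal (EReal.coe_ne_top _)
    rw [← h0, resourcefulness] at hpos
    simp only [iInf_lt_iff] at hpos
    obtain ⟨σ, hσ, hlt⟩ := hpos
    refine ⟨σ, hσ, ?_⟩
    by_contra! hge
    exact absurd (EReal.div_le_div_right_of_nonneg log_two_pos_ereal.le
      (ENNReal.log_le_log hge)) (not_le.2 hlt)
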